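/- Let $m>1$ be an integer and let $0<\delta<1$ be real. For $x\in\mathbb N$ let $S_x$ be the set of positive integers $n\le x$ that have a prime factor $p>(\log x)^{1+\delta}$ such that $\frac{p-1}{2}$ is an integer coprime to $m$. Then $$\lim_{x\to\infty}\frac{|S_x|}{x}=1 .$$ Moreover, let $\mathcal P_x$ be the set of odd primes $p$ with $(\log x)^{1+\delta}<p\le x$ and $\gcd\left(\frac{p-1}{2},m\right)=1$, and let $B(x)\ge 0$ be defined by $$B(x)^2=\sum_{\substack{p\in\mathcal P_x,\ \nu\ge 1\\ p^\nu\le x}}\frac{1}{p^{\nu}} .$$ Then for every function $g:\mathbb N\to\mathbb R$ with $g(x)\to 0$ as $x\to\infty$, and every real $\epsilon$ with $0<\epsilon<1$, $$\bigl|\{1,\dots,x\}\setminus S_x\bigr|\ \le\ x\cdot\frac{2+g(x)}{B(x)^{2\epsilon}}$$ for all sufficiently large $x$ (depending on $m,\delta,g,\epsilon$). -/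

import Mathlib

open Filter Topology

noncomputable section

/-- `d_x(S) = |S ∩ {1, …, x}| / x`. -/
def densityUpTo (S : Set ℕ) (x : ℕ) : ℝ :=
  ((S ∩ Set.Icc 1 x).ncard : ℝ) / (x : ℝ)

/-- The primes `p` for which `(p - 1) / 2` is coprime to `m`. For odd `p` the natural-number
division is exact. For `p = 2` it gives `0`, and `gcd 0 m = m`, so that `2` is excluded
whenever `m > 1`. -/
def goodPrimes (m : ℕ) : Set ℕ :=
  {p | p.Prime ∧ Nat.Coprime ((p - 1) / 2) m}

/-- The set `S_x` of positive integers `n ≤ x` having a prime factor `p > (log x)^(1+δ)` with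
`(p - 1) / 2` coprime to `m`. -/
def sievedSet (m : ℕ) (δ : ℝ) (x : ℕ) : Set ℕ :=
  {n | 1 ≤ n ∧ n ≤ x ∧ ∃ p ∈ goodPrimes m, p ∣ n ∧ Real.log x ^ (1 + δ) < (p : ℝ)}

/-- The set of primes `p` with `(p - 1) / 2` coprime to `m` and `(log x)^(1+δ) < p ≤ x`. -/
def goodPrimesUpTo (m : ℕ) (δ : ℝ) (x : ℕ) : Set ℕ :=
  {p | p ∈ goodPrimes m ∧ Real.log x ^ (1 + δ) < (p : ℝ) ∧ p ≤ x}

/-- The prime powers `p ^ ν ≤ x`, `ν ≥ 1`, of the primes `p` in `goodPrimesUpTo m δ x`. -/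
def goodPrimePowers (m : ℕ) (δ : ℝ) (x : ℕ) : Set ℕ :=
  {q | q ≤ x ∧ ∃ p ∈ goodPrimesUpTo m δ x, ∃ ν : ℕ, 1 ≤ ν ∧ q = p ^ ν}

open Classical in
/-- `B(x)`, the nonnegative square root of the sum of `1 / p ^ ν` over `goodPrimePowers m δ x`. -/
def normB (m : ℕ) (δ : ℝ) (x : ℕ) : ℝ :=
  Real.sqrt (∑ q ∈ (Finset.Icc 1 x).filter (fun q => q ∈ goodPrimePowers m δ x), 1 / (q : ℝ))

end

/-! The proof is a second-moment argument. Let `A` be the sum of `1 / p` over the good primes in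
`((log x)^(1+δ), x]`. Turán's inequality (`card_filter_forall_not_dvd_mul_sum_inv_le`) leaves at
most `3x / A` integers up to `x` outside `S_x`, so density one amounts to `A → ∞`.

Every prime `p ≡ -1 (mod 2m)` is good, so Dirichlet's theorem applies in quantitative form. Near `s
= 1` the sum of `log p / p ^ s` over the class is at least `c / (s - 1) - O(1)` with `c = 1 /
φ(2m)`. Cutting it to `Y < p ≤ x` costs about `(log Y)^2`, and integrating in `s` then gives `A` a
lower bound of order `log log x` (`tendsto_sum_inv_prime_residueClass`).

Higher prime powers at most double the sum, so `B^2 ≤ 2A` and the exceptional set has size at most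
`6x / B^2`. Since `ε < 1`, the spare factor `B^(2 - 2ε)` eventually absorbs the 6. -/

/-! ### Prime sums in a residue class near `s = 1` -/

open ArithmeticFunction ArithmeticFunction.vonMangoldt in
/-- Truncated form of `LSeries_residueClass_lower_bound`: a lower bound for the sum of
`log p / p ^ s` over the primes `Y < p ≤ N` in an invertible residue class. -/
lemma exists_le_sum_log_div_rpow_residueClass {q : ℕ} [NeZero q] {a : ZMod q} (ha : IsUnit a) :
    ∃ C : ℝ, ∀ (Y N : ℕ) (η s : ℝ), 1 ≤ Y → 1 ≤ N → 0 < η → 1 + η ≤ s → s ≤ 2 →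
      (q.totient : ℝ)⁻¹ / (s - 1) - C - Real.log Y * (1 + Real.log Y)
          - 4 / η * (N : ℝ) ^ (-(η / 2)) * ∑' n : ℕ, 1 / (n : ℝ) ^ (1 + η / 4) ≤
        ∑ p ∈ (Finset.Ioc Y N).filter (fun p : ℕ ↦ p.Prime ∧ (p : ZMod q) = a),
          Real.log p * (p : ℝ) ^ (-s) := by
  obtain ⟨C, hC⟩ := LSeries_residueClass_lower_bound ha
  have hnp := summable_residueClass_non_primes_div a
  -- Proper prime powers, weighted at `s = 1`: their convergent sum bounds their contribution
  -- uniformly in `s ≥ 1`.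
  set w : ℕ → ℝ := fun n ↦ (if n.Prime then 0 else residueClass a n) / n with hw
  have hw0 : ∀ n, 0 ≤ w n := fun n ↦ by
    simp only [hw]
    split_ifs
    · simp
    · exact div_nonneg (residueClass_nonneg a n) n.cast_nonneg
  refine ⟨C + ∑' n, w n, fun Y N η s hY hN hη hs hs2 ↦ ?_⟩
  set f : ℕ → ℝ := fun n ↦ residueClass a n / (n : ℝ) ^ s with hf
  have hfs : Summable f := LSeries.summable_real_of_abscissaOfAbsConv_lt <|
    (abscissaOfAbsConv_residueClass_le_one a).trans_lt (by norm_cast; linarith)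
  have hlow : (q.totient : ℝ)⁻¹ / (s - 1) - C ≤ ∑' n, f n := hC ⟨by linarith, hs2⟩
  rw [← hfs.sum_add_tsum_nat_add (N + 1)] at hlow
  have hlog (n : ℕ) : residueClass a n ≤ Real.log n :=
    (residueClass_le a n).trans vonMangoldt_le_log
  -- the tail
  have hz : Summable fun n : ℕ ↦ 1 / (n : ℝ) ^ (1 + η / 4) :=
    Real.summable_one_div_nat_rpow.mpr (by linarith)
  have htail : ∑' n, f (n + (N + 1)) ≤
      4 / η * (N : ℝ) ^ (-(η / 2)) * ∑' n : ℕ, 1 / (n : ℝ) ^ (1 + η / 4) := by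
    have hterm (n : ℕ) : f (n + (N + 1)) ≤
        4 / η * (N : ℝ) ^ (-(η / 2)) * (1 / ((n + (N + 1) : ℕ) : ℝ) ^ (1 + η / 4)) := by
      set k := n + (N + 1) with hk
      have hNk : (N : ℝ) ≤ k := by rw [hk]; push_cast; linarith [n.cast_nonneg (α := ℝ)]
      have hN0 : (0 : ℝ) < N := by exact_mod_cast hN
      have hk0 : (0 : ℝ) < k := hN0.trans_le hNk
      have hk1 : (1 : ℝ) ≤ k := le_trans (by exact_mod_cast hN) hNk
      -- Of the decay `k ^ (-η)`, a quarter pays for `log k`, a quarter keeps the series convergent,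
      -- and the remaining half gives the factor `N ^ (-η / 2)`.
      calc f k ≤ (k : ℝ) ^ (η / 4) / (η / 4) / (k : ℝ) ^ (1 + η) := by
            simp only [hf]
            gcongr
            · exact (hlog k).trans (Real.log_le_rpow_div hk0.le (by positivity))
        _ = 4 / η * (k : ℝ) ^ (-(η / 2)) * (1 / (k : ℝ) ^ (1 + η / 4)) := by
            rw [one_div, ← Real.rpow_neg hk0.le, mul_assoc, ← Real.rpow_add hk0, div_eq_mul_inv _
              ((k : ℝ) ^ (1 + η)), ← Real.rpow_neg hk0.le, div_mul_eq_mul_div,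
              ← Real.rpow_add hk0,
              show η / 4 + -(1 + η) = -(η / 2) + -(1 + η / 4) by ring]
            field_simp
        _ ≤ _ := by
            have := Real.rpow_le_rpow_of_nonpos hN0 hNk (show -(η / 2) ≤ 0 by linarith)
            gcongr
    calc ∑' n, f (n + (N + 1))
        ≤ ∑' n : ℕ, 4 / η * (N : ℝ) ^ (-(η / 2)) *
            (1 / ((n + (N + 1) : ℕ) : ℝ) ^ (1 + η / 4)) :=
          Summable.tsum_le_tsum hterm ((summable_nat_add_iff (N + 1)).mpr hfs)
            (((summable_nat_add_iff (N + 1)).mpr hz).mul_left _)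
      _ = 4 / η * (N : ℝ) ^ (-(η / 2)) *
            ∑' n : ℕ, (1 / ((n + (N + 1) : ℕ) : ℝ) ^ (1 + η / 4)) := tsum_mul_left
      _ ≤ _ := by
          refine mul_le_mul_of_nonneg_left ?_ (by positivity)
          rw [← hz.sum_add_tsum_nat_add (N + 1) (f := fun n : ℕ ↦ 1 / (n : ℝ) ^ (1 + η / 4))]
          exact le_add_of_nonneg_left (Finset.sum_nonneg fun _ _ ↦ by positivity)
  -- the initial segment
  have hpt : ∀ n ∈ Finset.range (N + 1), f n ≤
      (if Y < n ∧ n.Prime ∧ (n : ZMod q) = a then Real.log n * (n : ℝ) ^ (-s) else 0) + w n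
        + (if 1 ≤ n ∧ n ≤ Y then Real.log Y * (n : ℝ)⁻¹ else 0) := by
    intro n hn
    have e1 : 0 ≤ (if Y < n ∧ n.Prime ∧ (n : ZMod q) = a then
        Real.log n * (n : ℝ) ^ (-s) else 0) := by
      split_ifs
      · exact mul_nonneg (Real.log_natCast_nonneg n) (by positivity)
      · rfl
    have e3 : 0 ≤ (if 1 ≤ n ∧ n ≤ Y then Real.log Y * (n : ℝ)⁻¹ else 0) := by
      split_ifs
      · exact mul_nonneg (Real.log_natCast_nonneg Y) (by positivity)
      · rfl
    rcases Nat.eq_zero_or_pos n with rfl | hn0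
    · rw [show f 0 = 0 by simp [hf]]
      exact add_nonneg (add_nonneg e1 (hw0 0)) e3
    have hn0' : (1 : ℝ) ≤ n := by exact_mod_cast hn0
    have hpow : (n : ℝ) ≤ (n : ℝ) ^ s := by
      conv_lhs => rw [← Real.rpow_one (n : ℝ)]
      exact Real.rpow_le_rpow_of_exponent_le hn0' (by linarith)
    by_cases hp : n.Prime
    · by_cases hna : (n : ZMod q) = a
      · by_cases hYn : Y < n
        · rw [if_pos ⟨hYn, hp, hna⟩]
          have : f n ≤ Real.log n * (n : ℝ) ^ (-s) := by
            rw [Real.rpow_neg (by positivity), ← div_eq_mul_inv]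
            simp only [hf]
            gcongr
            exact hlog n
          linarith [hw0 n]
        · rw [if_pos (show 1 ≤ n ∧ n ≤ Y from ⟨hn0, not_lt.mp hYn⟩)]
          have : f n ≤ Real.log Y * (n : ℝ)⁻¹ := by
            rw [← div_eq_mul_inv]
            simp only [hf]
            have h1 : Real.log n ≤ Real.log Y :=
              Real.log_le_log (by positivity) (by exact_mod_cast not_lt.mp hYn)
            exact div_le_div₀ (Real.log_natCast_nonneg Y) ((hlog n).trans h1) (by positivity) hpow
          linarith [hw0 n]
      · have : f n = 0 := by
          simp only [hf, residueClass]
          rw [Set.indicator_of_notMem (by simpa using hna), zero_div]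
        linarith [hw0 n]
    · have : f n ≤ w n := by
        simp only [hf, hw, if_neg hp]
        exact div_le_div_of_nonneg_left (residueClass_nonneg a n) (by positivity) hpow
      linarith
  have hfin := Finset.sum_le_sum hpt
  rw [Finset.sum_add_distrib, Finset.sum_add_distrib, ← Finset.sum_filter, ← Finset.sum_filter,
    ← Finset.mul_sum] at hfin
  have h1 : (Finset.range (N + 1)).filter (fun n ↦ Y < n ∧ n.Prime ∧ (n : ZMod q) = a) =
      (Finset.Ioc Y N).filter (fun p : ℕ ↦ p.Prime ∧ (p : ZMod q) = a) := by
    ext n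
    simp only [Finset.mem_filter, Finset.mem_range, Finset.mem_Ioc, Nat.lt_succ_iff]
    tauto
  have h2 : ∑ n ∈ Finset.range (N + 1), w n ≤ ∑' n, w n := hnp.sum_le_tsum _ fun n _ ↦ hw0 n
  have h3 : Real.log Y * ∑ n ∈ (Finset.range (N + 1)).filter (fun n ↦ 1 ≤ n ∧ n ≤ Y), (n : ℝ)⁻¹ ≤
      Real.log Y * (1 + Real.log Y) := by
    refine mul_le_mul_of_nonneg_left ?_ (Real.log_natCast_nonneg Y)
    refine le_trans ?_ (harmonic_le_one_add_log Y)
    rw [harmonic_eq_sum_Icc]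
    push_cast
    refine Finset.sum_le_sum_of_subset_of_nonneg (fun n hn ↦ ?_) fun _ _ _ ↦ by positivity
    simp only [Finset.mem_filter] at hn
    exact Finset.mem_Icc.mpr hn.2
  rw [h1] at hfin
  linarith

/-- If `∑ log p / p ^ s` dominates `c / (s - 1)` for `1 + η ≤ s ≤ 1 + θ`, then integrating in `s`
bounds `∑ 1 / p` from below. -/
lemma mul_log_div_le_sum_inv (P : Finset ℕ) (hP : ∀ p ∈ P, 1 ≤ p) {c η θ : ℝ} (hη : 0 < η)
    (hηθ : η ≤ θ) (h : ∀ s, 1 + η ≤ s → s ≤ 1 + θ →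
      c / (s - 1) ≤ ∑ p ∈ P, Real.log p * (p : ℝ) ^ (-s)) :
    c * Real.log (θ / η) ≤ ∑ p ∈ P, 1 / (p : ℝ) := by
  have hder (s : ℝ) (hs : 1 < s) :
      HasDerivAt (fun s : ℝ ↦ ∑ p ∈ P, (p : ℝ) ^ (-s) + c * Real.log (s - 1))
        (∑ p ∈ P, -(Real.log p * (p : ℝ) ^ (-s)) + c * (1 / (s - 1))) s := by
    refine HasDerivAt.add (HasDerivAt.fun_sum fun p hp ↦ ?_) ?_
    · have hp0 : (0 : ℝ) < p := by exact_mod_cast hP p hp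
      have := (hasDerivAt_neg s).const_rpow hp0
      simpa using this
    · exact (((hasDerivAt_id s).sub_const 1).log (by simp; linarith)).const_mul c
  -- The hypothesis `h` says precisely that this function has nonpositive derivative.
  have hanti : AntitoneOn (fun s : ℝ ↦ ∑ p ∈ P, (p : ℝ) ^ (-s) + c * Real.log (s - 1))
      (Set.Icc (1 + η) (1 + θ)) := by
    refine antitoneOn_of_deriv_nonpos (convex_Icc _ _)
      (fun s hs ↦ (hder s (by linarith [hs.1])).continuousAt.continuousWithinAt)
      (fun s hs ↦ ?_) fun s hs ↦ ?_
    · rw [interior_Icc] at hs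
      exact (hder s (by linarith [hs.1])).differentiableAt.differentiableWithinAt
    · rw [interior_Icc] at hs
      rw [(hder s (by linarith [hs.1])).deriv, Finset.sum_neg_distrib]
      have := h s hs.1.le hs.2.le
      rw [mul_one_div]
      linarith
  have key := hanti (Set.left_mem_Icc.mpr (by linarith)) (Set.right_mem_Icc.mpr (by linarith))
    (by linarith)
  simp only [add_sub_cancel_left] at key
  have h0 : 0 ≤ ∑ p ∈ P, (p : ℝ) ^ (-(1 + θ)) := Finset.sum_nonneg fun _ _ ↦ by positivity
  have h1 : ∑ p ∈ P, (p : ℝ) ^ (-(1 + η)) ≤ ∑ p ∈ P, 1 / (p : ℝ) := by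
    refine Finset.sum_le_sum fun p hp ↦ ?_
    rw [one_div, ← Real.rpow_neg_one]
    exact Real.rpow_le_rpow_of_exponent_le (by exact_mod_cast hP p hp) (by linarith)
  rw [Real.log_div (by linarith) hη.ne']
  linarith

/-! ### Turán's second-moment inequality -/

/-- Turán's inequality: few `n ≤ N` are free of prime factors from `P ⊆ [1, N]` when
`∑ 1 / p` is large. -/
lemma card_filter_forall_not_dvd_mul_sum_inv_le (N : ℕ) (P : Finset ℕ)
    (hP : ∀ p ∈ P, p.Prime) (hPN : P ⊆ Finset.Icc 1 N) :
    (((Finset.Icc 1 N).filter (fun n ↦ ∀ p ∈ P, ¬ p ∣ n)).card : ℝ) * ∑ p ∈ P, 1 / (p : ℝ) ≤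
      3 * N := by
  set A : ℝ := ∑ p ∈ P, 1 / (p : ℝ) with hA
  have hA0 : 0 ≤ A := Finset.sum_nonneg fun _ _ ↦ by positivity
  set d : ℕ → ℕ → ℝ := fun p n ↦ if p ∣ n then 1 else 0 with hd
  have hcount (k : ℕ) : ∑ n ∈ Finset.Icc 1 N, d k n = ((N / k : ℕ) : ℝ) := by
    simp only [hd]
    rw [Finset.sum_boole, ← Nat.Ioc_filter_dvd_card_eq_div]
    rfl
  -- Each floor `N / p` loses less than 1, hence the error `P.card`.
  have hlin : N * A - P.card ≤ ∑ n ∈ Finset.Icc 1 N, ∑ p ∈ P, d p n := by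
    rw [Finset.sum_comm, hA, Finset.mul_sum, Finset.card_eq_sum_ones, Nat.cast_sum,
      ← Finset.sum_sub_distrib]
    refine Finset.sum_le_sum fun p hp ↦ ?_
    rw [hcount, mul_one_div, ← Nat.floor_div_eq_div (K := ℝ)]
    push_cast
    linarith [Nat.lt_floor_add_one ((N : ℝ) / p)]
  -- Off the diagonal, divisibility by both primes is divisibility by `p * r`; the diagonal supplies
  -- the extra `N * A`.
  have hquad : ∑ n ∈ Finset.Icc 1 N, (∑ p ∈ P, d p n) ^ 2 ≤ N * A ^ 2 + N * A := by
    simp_rw [sq (∑ p ∈ P, d p _), Finset.sum_mul_sum]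
    rw [Finset.sum_comm]
    have hA2 : N * A ^ 2 + N * A =
        ∑ p ∈ P, (∑ r ∈ P, (N : ℝ) * (1 / (p : ℝ) * (1 / (r : ℝ))) + N * (1 / (p : ℝ))) := by
      rw [Finset.sum_add_distrib, ← Finset.mul_sum, sq, hA, Finset.sum_mul_sum, Finset.mul_sum]
      simp_rw [Finset.mul_sum]
    rw [hA2]
    refine Finset.sum_le_sum fun p hp ↦ ?_
    rw [Finset.sum_comm, ← Finset.sum_erase_add _ _ hp]
    refine add_le_add ?_ ?_
    · refine (Finset.sum_le_sum fun r hr ↦ ?_).trans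
        (Finset.sum_le_sum_of_subset_of_nonneg (Finset.erase_subset p P)
          fun _ _ _ ↦ by positivity)
      have hne : p ≠ r := (Finset.ne_of_mem_erase hr).symm
      have hcop := (Nat.coprime_primes (hP p hp) (hP r (Finset.mem_of_mem_erase hr))).mpr hne
      have : ∀ n, d p n * d r n = d (p * r) n := fun n ↦ by
        have hiff : p * r ∣ n ↔ p ∣ n ∧ r ∣ n :=
          ⟨fun h ↦ ⟨(dvd_mul_right p r).trans h, (dvd_mul_left r p).trans h⟩,
            fun h ↦ hcop.mul_dvd_of_dvd_of_dvd h.1 h.2⟩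
        simp only [hd, hiff, ite_and, ite_mul, one_mul, zero_mul]
      simp_rw [this, hcount]
      refine Nat.cast_div_le.trans (le_of_eq ?_)
      push_cast
      rw [one_div_mul_one_div, mul_one_div]
    · have : ∀ n, d p n * d p n = d p n := fun n ↦ by
        simp only [hd]; split_ifs <;> simp
      simp_rw [this, hcount]
      refine Nat.cast_div_le.trans (le_of_eq ?_)
      rw [mul_one_div]
  have hcard : (P.card : ℝ) ≤ N := by
    exact_mod_cast (Finset.card_le_card hPN).trans (by simp)
  have hvar : ∑ n ∈ Finset.Icc 1 N, (∑ p ∈ P, d p n - A) ^ 2 ≤ 3 * N * A := by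
    have : ∑ n ∈ Finset.Icc 1 N, (∑ p ∈ P, d p n - A) ^ 2 =
        ∑ n ∈ Finset.Icc 1 N, (∑ p ∈ P, d p n) ^ 2
          - 2 * A * ∑ n ∈ Finset.Icc 1 N, ∑ p ∈ P, d p n + N * A ^ 2 := by
      simp_rw [sub_sq]
      rw [Finset.sum_add_distrib, Finset.sum_sub_distrib, Finset.mul_sum]
      simp only [Finset.sum_const, Nat.card_Icc, add_tsub_cancel_right, nsmul_eq_mul]
      congr 2
      exact Finset.sum_congr rfl fun _ _ ↦ by ring
    rw [this]
    -- The terms in `N * A ^ 2` cancel, leaving `N * A + 2 * A * P.card ≤ 3 * N * A`.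
    nlinarith [mul_le_mul_of_nonneg_left hlin hA0, mul_le_mul_of_nonneg_left hcard hA0]
  have hlow : (((Finset.Icc 1 N).filter (fun n ↦ ∀ p ∈ P, ¬ p ∣ n)).card : ℝ) * A ^ 2 ≤
      ∑ n ∈ Finset.Icc 1 N, (∑ p ∈ P, d p n - A) ^ 2 := by
    rw [← nsmul_eq_mul, ← Finset.sum_const]
    refine (Finset.sum_le_sum fun n hn ↦ ?_).trans
      (Finset.sum_le_sum_of_subset_of_nonneg (Finset.filter_subset _ _) fun _ _ _ ↦ sq_nonneg _)
    have : ∑ p ∈ P, d p n = 0 := Finset.sum_eq_zero fun p hp ↦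
      if_neg ((Finset.mem_filter.mp hn).2 p hp)
    rw [this]
    exact le_of_eq (by ring)
  rcases hA0.eq_or_lt with h | h
  · rw [← h, mul_zero]; positivity
  · refine le_of_mul_le_mul_right ?_ h
    calc _ = (((Finset.Icc 1 N).filter (fun n ↦ ∀ p ∈ P, ¬ p ∣ n)).card : ℝ) * A ^ 2 := by ring
      _ ≤ _ := hlow.trans hvar

/-! ### Divergence of the reciprocal sum above a growing cutoff -/

/-- The reciprocals of the primes `Y(x) < p ≤ x` in an invertible residue class have a divergent
sum, as long as `Y(x)` grows at most like `(log x) ^ 2`. -/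
lemma tendsto_sum_inv_prime_residueClass {q : ℕ} [NeZero q] {a : ZMod q} (ha : IsUnit a)
    (Y : ℕ → ℕ) (hY1 : ∀ᶠ x in atTop, 1 ≤ Y x)
    (hY : ∀ᶠ x : ℕ in atTop, Real.log (Y x) ≤ 2 * Real.log (Real.log x)) :
    Tendsto (fun x : ℕ ↦ ∑ p ∈ (Finset.Ioc (Y x) x).filter
      (fun p : ℕ ↦ p.Prime ∧ (p : ZMod q) = a), 1 / (p : ℝ)) atTop atTop := by
  obtain ⟨C, hC⟩ := exists_le_sum_log_div_rpow_residueClass ha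
  set c : ℝ := (q.totient : ℝ)⁻¹ with hc
  have hφ : 0 < q.totient := Nat.totient_pos.mpr (NeZero.pos q)
  have hc0 : 0 < c := inv_pos.mpr (by exact_mod_cast hφ)
  have hc1 : c ≤ 1 := inv_le_one_of_one_le₀ (by exact_mod_cast hφ)
  -- With `u = √(log x)` the hypothesis reads `log Y ≤ 4 * log u`, so `D u` dominates all error
  -- terms, the 1 covering the tail. The integration runs from `η = 1 / u` to `θ = c / (2 * D u)`,
  -- and `θ / η → ∞` because `D u = o(u)`.
  set D : ℝ → ℝ := fun u ↦ |C| + 1 + 4 * Real.log u * (1 + 4 * Real.log u) with hD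
  have hu : Tendsto (fun x : ℕ ↦ √(Real.log x)) atTop atTop :=
    Real.tendsto_sqrt_atTop.comp (Real.tendsto_log_atTop.comp tendsto_natCast_atTop_atTop)
  have hDpos : ∀ᶠ u : ℝ in atTop, 1 ≤ D u := by
    filter_upwards [eventually_ge_atTop 1] with u hu
    have := Real.log_nonneg hu
    have h1 := abs_nonneg C
    simp only [hD]
    nlinarith
  have hDo : D =o[atTop] (id : ℝ → ℝ) := by
    have h2 : (fun u : ℝ ↦ Real.log u ^ 2) =o[atTop] (id : ℝ → ℝ) := Real.isLittleO_pow_log_id_atTop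
    have h1 : (fun u : ℝ ↦ Real.log u) =o[atTop] (id : ℝ → ℝ) := Real.isLittleO_log_id_atTop
    have h0 : (fun _ : ℝ ↦ |C| + 1) =o[atTop] (id : ℝ → ℝ) :=
      Asymptotics.isLittleO_const_id_atTop _
    have := (h0.add (h1.const_mul_left 4)).add (h2.const_mul_left 16)
    refine this.congr_left fun u ↦ ?_
    simp only [hD]
    ring
  have hratio : Tendsto (fun u : ℝ ↦ u / D u) atTop atTop := by
    have h := hDo.tendsto_div_nhds_zero
    have h' : Tendsto (fun u : ℝ ↦ D u / id u) atTop (𝓝[>] 0) := by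
      refine tendsto_nhdsWithin_iff.mpr ⟨h, ?_⟩
      filter_upwards [hDpos, eventually_gt_atTop 0] with u h1 h2
      exact div_pos (by linarith) h2
    refine h'.inv_tendsto_nhdsGT_zero.congr fun u ↦ ?_
    simp
  have hη : ∀ᶠ u : ℝ in atTop, 1 / u ≤ c / (2 * D u) := by
    filter_upwards [hratio.eventually_ge_atTop (2 / c), hDpos, eventually_gt_atTop 0]
      with u h1 h2 h3
    rw [div_le_div_iff₀ hc0 (by linarith)] at h1
    rw [div_le_div_iff₀ h3 (by linarith)]
    linarith
  -- Since `(s - 1) * ζ(s) → 1`, eventually `ζ(s) ≤ 2 / (s - 1)`, taken at `s = 1 + 1 / (4u)`.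
  have hzeta : ∀ᶠ u : ℝ in atTop, ∑' n : ℕ, 1 / (n : ℝ) ^ (1 + 1 / u / 4) ≤ 8 * u := by
    have hs : Tendsto (fun u : ℝ ↦ 1 + 1 / u / 4) atTop (𝓝[>] 1) := by
      refine tendsto_nhdsWithin_iff.mpr ⟨?_, ?_⟩
      · simpa using ((tendsto_inv_atTop_zero (𝕜 := ℝ)).div_const 4).const_add 1
      · filter_upwards [eventually_gt_atTop 0] with u hu
        simp only [Set.mem_Ioi]
        linarith [show 0 < 1 / u / 4 by positivity]
    filter_upwards [(tendsto_sub_mul_tsum_nat_rpow.comp hs).eventually_le_const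
      (show (1 : ℝ) < 2 by norm_num), eventually_gt_atTop 0] with u h hu
    simp only [Function.comp_apply, add_sub_cancel_left] at h
    rw [div_div, one_div_mul_eq_div, div_le_iff₀ (by positivity)] at h
    rw [div_div]
    linarith
  have hexp : ∀ᶠ u : ℝ in atTop, 32 * u ^ 2 * Real.exp (-(u / 2)) ≤ 1 := by
    have h := ((Real.tendsto_pow_mul_exp_neg_atTop_nhds_zero 2).comp
      (tendsto_id.atTop_div_const (show (0 : ℝ) < 2 by norm_num))).const_mul 128
    rw [mul_zero] at h
    filter_upwards [h.eventually_le_const zero_lt_one] with u hu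
    refine le_of_eq_of_le ?_ hu
    simp only [Function.comp_apply, id_eq]
    ring
  have hlog : Tendsto (fun x : ℕ ↦ c / 2 * Real.log (c / (2 * D √(Real.log x)) / (1 / √(Real.log x))))
      atTop atTop := by
    refine (Real.tendsto_log_atTop.comp ?_).const_mul_atTop (half_pos hc0)
    refine ((hratio.comp hu).const_mul_atTop (show 0 < c / 2 by positivity)).congr fun x ↦ ?_
    simp only [Function.comp_apply, one_div, div_inv_eq_mul]
    rw [← div_div]
    ring
  refine tendsto_atTop_mono' _ ?_ hlog
  filter_upwards [hu.eventually hDpos, hu.eventually hη, hu.eventually hzeta, hu.eventually hexp,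
    hY1, hY, hu.eventually_ge_atTop 1, eventually_ge_atTop 1] with x hD1 hη hzeta hexp hY1 hY hu1 hx1
  set u := √(Real.log x) with hu_def
  have hu0 : 0 < u := by linarith
  have hlogx : Real.log x = u ^ 2 := by
    rw [hu_def, Real.sq_sqrt (Real.log_natCast_nonneg x)]
  have hx0 : (0 : ℝ) < x := by exact_mod_cast hx1
  refine mul_log_div_le_sum_inv _ (fun p hp ↦ (Finset.mem_filter.mp hp).2.1.one_le)
    (by positivity) hη fun s hs1 hs2 ↦ ?_
  have hθ : c / (2 * D u) ≤ 1 := by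
    rw [div_le_one (by linarith)]
    linarith
  refine le_trans ?_ (hC (Y x) x (1 / u) s hY1 hx1 (by positivity) hs1 (by linarith))
  have htail : 4 / (1 / u) * (x : ℝ) ^ (-(1 / u / 2)) *
      ∑' n : ℕ, 1 / (n : ℝ) ^ (1 + 1 / u / 4) ≤ 1 := by
    have : (x : ℝ) ^ (-(1 / u / 2)) = Real.exp (-(u / 2)) := by
      rw [Real.rpow_def_of_pos hx0, hlogx]
      congr 1
      field_simp
    rw [this]
    calc _ ≤ 4 / (1 / u) * Real.exp (-(u / 2)) * (8 * u) := by gcongr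
      _ = 32 * u ^ 2 * Real.exp (-(u / 2)) := by
        rw [one_div, div_inv_eq_mul]
        ring
      _ ≤ 1 := hexp
  have hYD : Real.log (Y x) * (1 + Real.log (Y x)) ≤ 4 * Real.log u * (1 + 4 * Real.log u) := by
    rw [hlogx, Real.log_pow] at hY
    push_cast at hY
    have h0 := Real.log_natCast_nonneg (Y x)
    have : Real.log (Y x) ≤ 4 * Real.log u := by linarith
    have h4 : 0 ≤ 4 * Real.log u := h0.trans this
    gcongr
  have hs0 : 0 < s - 1 := by linarith [show 0 < 1 / u by positivity]
  -- This is the choice of `θ`: for `s ≤ 1 + θ` the errors consume at most half of the main term.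
  have hhalf : D u ≤ c / (s - 1) / 2 := by
    rw [div_div, le_div_iff₀ (by positivity)]
    have : s - 1 ≤ c / (2 * D u) := by linarith
    rw [le_div_iff₀ (by linarith)] at this
    linarith
  have : C + Real.log (Y x) * (1 + Real.log (Y x)) + 1 ≤ D u := by
    simp only [hD]
    linarith [le_abs_self C]
  rw [div_right_comm]
  linarith

/-! ### Good primes from the class `-1` modulo `2m` -/

/-- If `p + 1 = 2mk`, then `(p - 1) / 2 = mk - 1`, so a common divisor with `m` divides 1. -/
lemma mem_goodPrimes_of_natCast_eq_neg_one {m p : ℕ} (hp : p.Prime)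
    (h : (p : ZMod (2 * m)) = -1) : p ∈ goodPrimes m := by
  refine ⟨hp, ?_⟩
  have hdvd : 2 * m ∣ p + 1 := by
    rw [← ZMod.natCast_eq_zero_iff]
    push_cast
    rw [h, neg_add_cancel]
  obtain ⟨k, hk⟩ := hdvd
  have hk0 : 0 < m * k := by
    rcases Nat.eq_zero_or_pos (m * k) with h0 | h0
    · rw [mul_assoc, h0] at hk
      omega
    · exact h0
  have hhalf : (p - 1) / 2 + 1 = m * k := by
    rw [mul_assoc] at hk
    omega
  have hg1 := Nat.gcd_dvd_left ((p - 1) / 2) m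
  have hg2 := (Nat.gcd_dvd_right ((p - 1) / 2) m).mul_right k
  rw [← hhalf] at hg2
  exact Nat.dvd_one.mp ((Nat.dvd_add_right hg1).mp hg2)

lemma finite_goodPrimesUpTo (m : ℕ) (δ : ℝ) (x : ℕ) : (goodPrimesUpTo m δ x).Finite :=
  (Set.finite_Iic x).subset fun _ hp ↦ hp.2.2

/-- `goodPrimesUpTo` as a finset. -/
noncomputable def goodPrimesFinset (m : ℕ) (δ : ℝ) (x : ℕ) : Finset ℕ :=
  (finite_goodPrimesUpTo m δ x).toFinset

lemma mem_goodPrimesFinset {m : ℕ} {δ : ℝ} {x p : ℕ} :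
    p ∈ goodPrimesFinset m δ x ↔ p ∈ goodPrimesUpTo m δ x :=
  Set.Finite.mem_toFinset _

lemma prime_of_mem_goodPrimesFinset {m : ℕ} {δ : ℝ} {x p : ℕ}
    (hp : p ∈ goodPrimesFinset m δ x) : p.Prime :=
  (mem_goodPrimesFinset.mp hp).1.1

lemma tendsto_sum_inv_goodPrimesFinset {m : ℕ} (hm : 0 < m) {δ : ℝ} (hδ0 : 0 < δ) (hδ1 : δ < 1) :
    Tendsto (fun x ↦ ∑ p ∈ goodPrimesFinset m δ x, 1 / (p : ℝ)) atTop atTop := by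
  have : NeZero (2 * m) := ⟨by positivity⟩
  have hlog : Tendsto (fun x : ℕ ↦ Real.log x) atTop atTop :=
    Real.tendsto_log_atTop.comp tendsto_natCast_atTop_atTop
  refine tendsto_atTop_mono (fun x ↦ ?_)
    (tendsto_sum_inv_prime_residueClass (isUnit_one.neg : IsUnit (-1 : ZMod (2 * m)))
      (fun x ↦ ⌊Real.log x ^ (1 + δ)⌋₊) ?_ ?_)
  · refine Finset.sum_le_sum_of_subset_of_nonneg (fun p hp ↦ ?_) fun _ _ _ ↦ by positivity
    rw [Finset.mem_filter, Finset.mem_Ioc] at hp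
    exact mem_goodPrimesFinset.mpr
      ⟨mem_goodPrimes_of_natCast_eq_neg_one hp.2.1 hp.2.2, Nat.lt_of_floor_lt hp.1.1, hp.1.2⟩
  · filter_upwards [hlog.eventually_ge_atTop 1] with x hx
    exact (Nat.one_le_floor_iff _).mpr (Real.one_le_rpow hx (by linarith))
  · filter_upwards [hlog.eventually_ge_atTop 1] with x hx
    have h1 : 1 ≤ Real.log x ^ (1 + δ) := Real.one_le_rpow hx (by linarith)
    have h2 : (0 : ℝ) < ⌊Real.log x ^ (1 + δ)⌋₊ := by
      exact_mod_cast (Nat.one_le_floor_iff _).mpr h1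
    calc Real.log ⌊Real.log x ^ (1 + δ)⌋₊ ≤ Real.log (Real.log x ^ (1 + δ)) :=
          Real.log_le_log h2 (Nat.floor_le (by linarith))
      _ = (1 + δ) * Real.log (Real.log x) := Real.log_rpow (by linarith) _
      _ ≤ _ := mul_le_mul_of_nonneg_right (by linarith) (Real.log_nonneg hx)

/-! ### The exceptional set and the comparison of `B(x)^2` with the prime sum -/

lemma Icc_diff_sievedSet (m : ℕ) (δ : ℝ) (x : ℕ) :
    Set.Icc 1 x \ sievedSet m δ x =
      ((Finset.Icc 1 x).filter (fun n ↦ ∀ p ∈ goodPrimesFinset m δ x, ¬ p ∣ n) : Finset ℕ) := by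
  ext n
  simp only [Set.mem_sdiff, Set.mem_Icc, sievedSet, Set.mem_ofPred_eq, Finset.coe_filter,
    Finset.mem_Icc, mem_goodPrimesFinset]
  refine and_congr_right fun hn ↦ ⟨fun h p hp hpn ↦ h ⟨hn.1, hn.2, p, hp.1, hpn, hp.2.1⟩, ?_⟩
  rintro h ⟨-, -, p, hp, hpn, hlog⟩
  exact h p ⟨hp, hlog, (Nat.le_of_dvd hn.1 hpn).trans hn.2⟩ hpn

lemma ncard_Icc_diff_sievedSet_mul_le (m : ℕ) (δ : ℝ) (x : ℕ) :
    ((Set.Icc 1 x \ sievedSet m δ x).ncard : ℝ) * ∑ p ∈ goodPrimesFinset m δ x, 1 / (p : ℝ) ≤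
      3 * x := by
  rw [Icc_diff_sievedSet, Set.ncard_coe_finset]
  exact card_filter_forall_not_dvd_mul_sum_inv_le x _ (fun p ↦ prime_of_mem_goodPrimesFinset)
    fun p hp ↦ Finset.mem_Icc.mpr
      ⟨(prime_of_mem_goodPrimesFinset hp).one_le, (mem_goodPrimesFinset.mp hp).2.2⟩

lemma normB_nonneg (m : ℕ) (δ : ℝ) (x : ℕ) : 0 ≤ normB m δ x := Real.sqrt_nonneg _

lemma sum_inv_goodPrimesFinset_le_normB_sq (m : ℕ) (δ : ℝ) (x : ℕ) :
    ∑ p ∈ goodPrimesFinset m δ x, 1 / (p : ℝ) ≤ normB m δ x ^ 2 := by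
  classical
  rw [normB, Real.sq_sqrt (Finset.sum_nonneg fun _ _ ↦ by positivity)]
  refine Finset.sum_le_sum_of_subset_of_nonneg (fun p hp ↦ ?_) fun _ _ _ ↦ by positivity
  have hp' := mem_goodPrimesFinset.mp hp
  exact Finset.mem_filter.mpr ⟨Finset.mem_Icc.mpr ⟨hp'.1.1.one_le, hp'.2.2⟩, hp'.2.2, p, hp', 1,
    le_rfl, (pow_one p).symm⟩

lemma sum_Icc_inv_pow_le {p : ℕ} (hp : 2 ≤ p) (n : ℕ) :
    ∑ ν ∈ Finset.Icc 1 n, 1 / (p : ℝ) ^ ν ≤ 2 * (1 / (p : ℝ)) := by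
  have hp' : (2 : ℝ) ≤ p := by exact_mod_cast hp
  -- The geometric tail is kept so that the induction closes; the base case is `1 / (p - 1) ≤ 2 /
  -- p`.
  suffices h : ∑ ν ∈ Finset.Icc 1 n, 1 / (p : ℝ) ^ ν ≤
      2 * (1 / (p : ℝ)) - 1 / (p : ℝ) ^ n * (1 / (p - 1)) by
    have : 0 ≤ 1 / (p : ℝ) ^ n * (1 / (p - 1)) :=
      mul_nonneg (by positivity) (one_div_nonneg.mpr (by linarith))
    linarith
  have hp1 : (p : ℝ) - 1 ≠ 0 := by linarith
  induction n with
  | zero =>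
    simp only [Finset.Icc_eq_empty_of_lt zero_lt_one, Finset.sum_empty, pow_zero]
    rw [sub_nonneg, ← sub_nonneg]
    have : 2 * (1 / (p : ℝ)) - 1 / 1 * (1 / (p - 1)) = (p - 2) / (p * (p - 1)) := by
      field_simp
      ring
    rw [this]
    exact div_nonneg (by linarith) (mul_nonneg (by linarith) (by linarith))
  | succ n ih =>
    rw [Finset.sum_Icc_succ_top (by omega)]
    have : 1 / (p : ℝ) ^ (n + 1) =
        1 / (p : ℝ) ^ n * (1 / (p - 1)) - 1 / (p : ℝ) ^ (n + 1) * (1 / (p - 1)) := by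
      field_simp
      ring
    linarith

lemma normB_sq_le (m : ℕ) (δ : ℝ) (x : ℕ) :
    normB m δ x ^ 2 ≤ 2 * ∑ p ∈ goodPrimesFinset m δ x, 1 / (p : ℝ) := by
  classical
  rw [normB, Real.sq_sqrt (Finset.sum_nonneg fun _ _ ↦ by positivity)]
  calc _ ≤ ∑ q ∈ (goodPrimesFinset m δ x ×ˢ Finset.Icc 1 x).image (fun z : ℕ × ℕ ↦ z.1 ^ z.2),
        1 / ((q : ℕ) : ℝ) := by
        refine Finset.sum_le_sum_of_subset_of_nonneg (fun q hq ↦ ?_) fun _ _ _ ↦ by positivity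
        obtain ⟨hqx, p, hp, ν, hν, rfl⟩ := (Finset.mem_filter.mp hq).2
        refine Finset.mem_image.mpr ⟨(p, ν), Finset.mem_product.mpr
          ⟨mem_goodPrimesFinset.mpr hp, Finset.mem_Icc.mpr ⟨hν, ?_⟩⟩, rfl⟩
        exact (Nat.lt_pow_self hp.1.1.one_lt).le.trans hqx
    _ ≤ ∑ z ∈ goodPrimesFinset m δ x ×ˢ Finset.Icc 1 x, 1 / ((z.1 ^ z.2 : ℕ) : ℝ) :=
        Finset.sum_image_le_of_nonneg (g := fun z : ℕ × ℕ ↦ z.1 ^ z.2)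
          (f := fun q : ℕ ↦ 1 / (q : ℝ)) fun _ _ ↦ by positivity
    _ = ∑ p ∈ goodPrimesFinset m δ x, ∑ ν ∈ Finset.Icc 1 x, 1 / (p : ℝ) ^ ν := by
        rw [Finset.sum_product]
        push_cast
        rfl
    _ ≤ _ := by
        rw [Finset.mul_sum]
        exact Finset.sum_le_sum fun p hp ↦
          sum_Icc_inv_pow_le (prime_of_mem_goodPrimesFinset hp).two_le x

/-! ### Density one and the quantitative bound -/

theorem proposition3p4 (m : ℕ) (hm : 1 < m) (δ : ℝ) (hδ0 : 0 < δ) (hδ1 : δ < 1) :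
    Tendsto (fun x : ℕ => densityUpTo (sievedSet m δ x) x) atTop (𝓝 1) ∧
    ∀ g : ℕ → ℝ, Tendsto g atTop (𝓝 0) →
      ∀ ε : ℝ, 0 < ε → ε < 1 →
        ∀ᶠ x : ℕ in atTop,
          ((Set.Icc 1 x \ sievedSet m δ x).ncard : ℝ) ≤
            (x : ℝ) * ((2 + g x) / normB m δ x ^ (2 * ε)) := by
  have hA := tendsto_sum_inv_goodPrimesFinset (by omega : 0 < m) hδ0 hδ1
  refine ⟨?_, fun g hg ε hε0 hε1 ↦ ?_⟩
  · have h0 : Tendsto (fun x : ℕ ↦ ((Set.Icc 1 x \ sievedSet m δ x).ncard : ℝ) / x) atTop (𝓝 0) := by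
      have hlim := (tendsto_inv_atTop_zero.comp hA).const_mul 3
      rw [mul_zero] at hlim
      refine tendsto_of_tendsto_of_tendsto_of_le_of_le' tendsto_const_nhds hlim
        (Eventually.of_forall fun x ↦ by positivity) ?_
      filter_upwards [hA.eventually_gt_atTop 0, eventually_gt_atTop 0] with x hAx hx
      have hx' : (0 : ℝ) < x := by exact_mod_cast hx
      rw [Function.comp_apply, ← div_eq_mul_inv, div_le_div_iff₀ hx' hAx]
      exact ncard_Icc_diff_sievedSet_mul_le m δ x
    have h1 := h0.const_sub 1
    rw [sub_zero] at h1
    refine h1.congr' ?_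
    filter_upwards [eventually_gt_atTop 0] with x hx
    have hx' : (x : ℝ) ≠ 0 := by exact_mod_cast hx.ne'
    have hcard := Set.ncard_inter_add_ncard_sdiff_eq_ncard (Set.Icc 1 x) (sievedSet m δ x)
      (Set.finite_Icc 1 x)
    rw [← Finset.coe_Icc, Set.ncard_coe_finset, Nat.card_Icc, Nat.add_sub_cancel, Finset.coe_Icc] at hcard
    rw [densityUpTo, Set.inter_comm, eq_div_iff hx', sub_mul, div_mul_cancel₀ _ hx', one_mul,
      sub_eq_iff_eq_add]
    exact_mod_cast hcard.symm
  · have hB : Tendsto (fun x ↦ normB m δ x ^ 2) atTop atTop :=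
      tendsto_atTop_mono (sum_inv_goodPrimesFinset_le_normB_sq m δ) hA
    have hpow : Tendsto (fun x ↦ (normB m δ x ^ 2) ^ (1 - ε)) atTop atTop :=
      (tendsto_rpow_atTop (by linarith)).comp hB
    -- The 6 is Turán's 3 times the 2 of `normB_sq_le`. From `g x ≥ -1` comes `2 + g x ≥ 1`, so the
    -- bound with numerator 1 suffices.
    filter_upwards [hA.eventually_gt_atTop 0, hB.eventually_gt_atTop 0,
      hpow.eventually_ge_atTop 6, hg.eventually_const_le (show (-1 : ℝ) < 0 by norm_num)]
      with x hAx hBx hpow hgx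
    have hx0 : (0 : ℝ) ≤ x := x.cast_nonneg
    have hε : normB m δ x ^ (2 * ε) = (normB m δ x ^ 2) ^ ε := by
      rw [Real.rpow_mul (normB_nonneg m δ x), Real.rpow_two]
    have hsplit : (normB m δ x ^ 2) ^ (1 - ε) * (normB m δ x ^ 2) ^ ε = normB m δ x ^ 2 := by
      rw [← Real.rpow_add hBx, sub_add_cancel, Real.rpow_one]
    have hεpos : 0 < (normB m δ x ^ 2) ^ ε := Real.rpow_pos_of_pos hBx ε
    rw [hε, ← mul_div_assoc, le_div_iff₀ hεpos]
    have hcount := ncard_Icc_diff_sievedSet_mul_le m δ x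
    set M : ℝ := ((Set.Icc 1 x \ sievedSet m δ x).ncard : ℝ)
    have hM : 0 ≤ M := Nat.cast_nonneg _
    have h6 : 6 * (M * (normB m δ x ^ 2) ^ ε) ≤ 6 * x := by
      calc 6 * (M * (normB m δ x ^ 2) ^ ε)
          = M * (6 * (normB m δ x ^ 2) ^ ε) := by ring
        _ ≤ M * ((normB m δ x ^ 2) ^ (1 - ε) * (normB m δ x ^ 2) ^ ε) := by gcongr
        _ = M * normB m δ x ^ 2 := by rw [hsplit]
        _ ≤ M * (2 * ∑ p ∈ goodPrimesFinset m δ x, 1 / (p : ℝ)) := by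
            gcongr
            exact normB_sq_le m δ x
        _ ≤ 6 * x := by linarith
    nlinarith
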